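/- Let $A$ be a (not necessarily unital) $C^*$-algebra. Let $\mathcal P(A)$ be the set of pure states of $A$ with the weak-$*$ topology and uniformity, let $\hat A$ be the spectrum of $A$ (unitary equivalence classes of nonzero irreducible representations) with the Jacobson topology, and let $p_A:\mathcal P(A)\to\hat A$ send a pure state to the class of its GNS representation. Each fibre $p_A^{-1}([\pi])$ carries the Kähler structure of the projective space of $H_\pi$, transported by $\omega\mapsto[x_\omega]$, where $x_\omega\in H_\pi$ is a unit vector with $\omega(a)=\langle x_\omega,\pi(a)x_\omega\rangle$ for all $a\in A$; the resulting uniform Kähler bundle is denoted $(\mathcal P(A),p_A,\hat A)$. For $U\subseteq\hat A$, its restriction $(\mathcal P(A),p_A,\hat A)_U$ is the bundle $(p_A^{-1}(U),\,p_A|_{p_A^{-1}(U)},\,U)$ with the inherited structures. For a closed two-sided ideal $I$ of $A$ put $\hat A^I=\{[\pi]\in\hat A:\pi(I)\neq 0\}$. Then: (a) The map $I\mapsto(\mathcal P(A),p_A,\hat A)_{\hat A^I}$ is a bijection from the set of closed two-sided ideals of $A$ onto the set of restrictions of $(\mathcal P(A),p_A,\hat A)$ to open subsets of $\hat A$. Moreover,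 for every closed two-sided ideal $I$, $$I=\ker\bigoplus_{[\pi]\in\hat A\setminus\hat A^I}\pi ,$$ where one representative $\pi$ is chosen, arbitrarily, from each class. (b) The map $A/I\mapsto(\mathcal P(A),p_A,\hat A)_{\hat A\setminus\hat A^I}$ is a bijection from the set of quotient $C^*$-algebras of $A$ onto the set of restrictions of $(\mathcal P(A),p_A,\hat A)$ to closed subsets of $\hat A$. Here a quotient $C^*$-algebra of $A$ is a surjective $*$-homomorphism $q:A\to B$ onto a $C^*$-algebra, two of them being identified when they differ by a $*$-isomorphism of their targets that is compatible with the quotient maps; for each closed two-sided ideal $I$ there is exactly one with kernel $I$, namely $A\to A/I$. -/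

import Mathlib

namespace CStarUKB

universe u v w

noncomputable section

open scoped ComplexOrder InnerProductSpace CStarAlgebra

/-! ### Closed ideals -/

/-- A norm-closed two-sided ideal of a C⋆-algebra. -/
structure ClosedIdeal (A : Type u) [NonUnitalCStarAlgebra A] extends Submodule ℂ A where
  mul_mem_left' : ∀ (a : A) {b : A}, b ∈ carrier → a * b ∈ carrier
  mul_mem_right' : ∀ {a : A} (b : A), a ∈ carrier → a * b ∈ carrier
  isClosed' : IsClosed carrier

namespace ClosedIdeal

variable {A : Type u} [NonUnitalCStarAlgebra A]

instance : SetLike (ClosedIdeal A) A where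
  coe I := I.carrier
  coe_injective I J h := by
    obtain ⟨I, _, _, _⟩ := I
    obtain ⟨J, _, _, _⟩ := J
    congr
    exact SetLike.coe_injective h

end ClosedIdeal

/-! ### Representations -/

/-- A ⋆-representation of a C⋆-algebra on a complex Hilbert space. -/
structure Rep (A : Type u) [NonUnitalCStarAlgebra A] where
  H : Type v
  [normed : NormedAddCommGroup H]
  [inner : InnerProductSpace ℂ H]
  [complete : CompleteSpace H]
  hom : A →⋆ₙₐ[ℂ] (H →L[ℂ] H)

attribute [instance] Rep.normed Rep.inner Rep.complete

variable {A : Type u} [NonUnitalCStarAlgebra A]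

/-- The kernel of a ⋆-homomorphism between C⋆-algebras, as a closed ideal. -/
def kerHom {B : Type v} [NonUnitalCStarAlgebra B] (φ : A →⋆ₙₐ[ℂ] B) : ClosedIdeal A where
  carrier := {a | φ a = 0}
  add_mem' {a b} ha hb := by
    simp only [Set.mem_ofPred_eq] at ha hb ⊢
    rw [map_add, ha, hb, add_zero]
  zero_mem' := map_zero φ
  smul_mem' c a ha := by
    simp only [Set.mem_ofPred_eq] at ha ⊢
    rw [map_smul, ha, smul_zero]
  mul_mem_left' a b hb := by
    simp only [Set.mem_ofPred_eq] at hb ⊢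
    rw [map_mul, hb, mul_zero]
  mul_mem_right' b hb := by
    simp only [Set.mem_ofPred_eq] at hb ⊢
    rw [map_mul, hb, zero_mul]
  isClosed' := isClosed_eq
    (AddMonoidHomClass.continuous_of_bound φ 1 fun a => by
      simpa using NonUnitalStarAlgHom.norm_apply_le φ a) continuous_const

theorem mem_kerHom {B : Type v} [NonUnitalCStarAlgebra B] (φ : A →⋆ₙₐ[ℂ] B) (a : A) :
    a ∈ kerHom φ ↔ φ a = 0 := Iff.rfl

namespace Rep

/-- The kernel of a representation. -/
def ker (π : Rep.{u, v} A) : ClosedIdeal A := kerHom π.hom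

/-- Unitary equivalence of representations. -/
def Equivalent (π : Rep.{u, v} A) (ρ : Rep.{u, w} A) : Prop :=
  ∃ U : π.H ≃ₗᵢ[ℂ] ρ.H, ∀ (a : A) (x : π.H), U (π.hom a x) = ρ.hom a (U x)

/-- A representation is irreducible if it is not the zero representation and its only closed
invariant subspaces are the trivial ones. -/
def IsIrreducible (π : Rep.{u, v} A) : Prop :=
  π.hom ≠ 0 ∧ ∀ K : Submodule ℂ π.H, IsClosed (K : Set π.H) →
    (∀ (a : A), ∀ x ∈ K, π.hom a x ∈ K) → K = ⊥ ∨ K = ⊤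

section DirectSum

variable {ι : Type w} (π : ι → Rep.{u, v} A)

theorem memℓp_apply (a : A) (x : lp (fun i => (π i).H) 2) :
    Memℓp (fun i => (π i).hom a (x i)) 2 := by
  have h : Memℓp (fun i => (‖a‖ : ℂ) • x i) 2 := (lp.memℓp x).const_smul _
  refine memℓp_gen ?_
  have h2 := h.summable (by norm_num)
  refine Summable.of_nonneg_of_le (fun i => by positivity) (fun i => ?_) h2
  refine Real.rpow_le_rpow (norm_nonneg _) ?_ (by norm_num)
  rw [norm_smul]
  simp only [Complex.norm_real, norm_norm]
  exact ((π i).hom a).le_of_opNorm_le (NonUnitalStarAlgHom.norm_apply_le _ a) _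

/-- The operator `⨁ πᵢ(a)` on the Hilbert space direct sum. -/
def directSumOp (a : A) : lp (fun i => (π i).H) 2 →L[ℂ] lp (fun i => (π i).H) 2 :=
  LinearMap.mkContinuous
    { toFun := fun x => ⟨fun i => (π i).hom a (x i), memℓp_apply π a x⟩
      map_add' := fun x y => by ext i; simp; rfl
      map_smul' := fun c x => by ext i; simp } ‖a‖ (fun x => by
        have key : ‖(⟨fun i => (π i).hom a (x i), memℓp_apply π a x⟩ :
            lp (fun i => (π i).H) 2)‖ ≤ ‖((‖a‖ : ℂ) • x)‖ := by
          refine lp.norm_mono (by norm_num) (fun i => ?_)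
          simp only [lp.coeFn_smul, Pi.smul_apply]
          rw [norm_smul]
          simp only [Complex.norm_real, norm_norm]
          exact ((π i).hom a).le_of_opNorm_le (NonUnitalStarAlgHom.norm_apply_le _ a) _
        refine key.trans ?_
        rw [norm_smul]
        simp)

@[simp]
theorem directSumOp_apply (a : A) (x : lp (fun i => (π i).H) 2) (i : ι) :
    (directSumOp π a x) i = (π i).hom a (x i) := rfl

/-- The direct sum of a family of representations, acting componentwise on the Hilbert space
direct sum. -/
def directSum : Rep.{u, max v w} A where
  H := lp (fun i => (π i).H) 2
  hom :=
    { toFun := directSumOp π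
      map_smul' := fun c a => by ext x i; simp
      map_zero' := by ext x i; simp
      map_add' := fun a b => by ext x i; simp
      map_mul' := fun a b => by ext x i; simp
      map_star' := fun a => by
        rw [ContinuousLinearMap.star_eq_adjoint, ContinuousLinearMap.eq_adjoint_iff]
        intro x y
        rw [lp.inner_eq_tsum, lp.inner_eq_tsum]
        congr 1
        ext i
        simp only [directSumOp_apply, map_star, ContinuousLinearMap.star_eq_adjoint]
        exact ContinuousLinearMap.adjoint_inner_left _ _ _ }

end DirectSum


theorem IsIrreducible.dense_orbit {π : Rep.{u, v} A} (h : π.IsIrreducible) {y : π.H}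
    (hy : y ≠ 0) (K : Submodule ℂ π.H) (hK : IsClosed (K : Set π.H))
    (hyK : ∀ a : A, π.hom a y ∈ K) : K = ⊤ := by
  let L₀ : Submodule ℂ π.H :=
    LinearMap.range ({ toFun := fun a => π.hom a y
                       map_add' := fun a b => by simp
                       map_smul' := fun c a => by simp } : A →ₗ[ℂ] π.H)
  have hmem : ∀ a, π.hom a y ∈ L₀ := fun a => ⟨a, rfl⟩
  have hle : L₀.topologicalClosure ≤ K := by
    refine Submodule.topologicalClosure_minimal _ ?_ hK
    rintro _ ⟨a, rfl⟩
    exact hyK a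
  have hinv : ∀ (a : A), ∀ x ∈ L₀.topologicalClosure, π.hom a x ∈ L₀.topologicalClosure := by
    intro a x hx
    refine map_mem_closure (π.hom a).continuous hx ?_
    rintro _ ⟨b, rfl⟩
    exact ⟨a * b, by simp⟩
  rcases h.2 _ L₀.isClosed_topologicalClosure hinv with h0 | h0
  · exfalso
    have hz : ∀ a, π.hom a y = 0 := fun a => by
      have := L₀.le_topologicalClosure (hmem a)
      rwa [h0, Submodule.mem_bot] at this
    rcases h.2 (Submodule.span ℂ {y}) (Submodule.closed_of_finiteDimensional _) (by
      intro a x hx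
      obtain ⟨c, rfl⟩ := Submodule.mem_span_singleton.1 hx
      simp [hz a]) with h1 | h1
    · exact hy (Submodule.span_singleton_eq_bot.1 h1)
    · refine h.1 ?_
      ext a x
      have hx : x ∈ Submodule.span ℂ {y} := h1 ▸ Submodule.mem_top
      obtain ⟨c, rfl⟩ := Submodule.mem_span_singleton.1 hx
      simp [hz a]
  · rw [h0] at hle
    exact top_le_iff.1 hle

/-- Kernels of irreducible representations are prime. -/
theorem IsIrreducible.prime {π : Rep.{u, v} A} (h : π.IsIrreducible) (s t : A)
    (hst : ∀ a, π.hom (s * a * t) = 0) : π.hom s = 0 ∨ π.hom t = 0 := by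
  by_contra hcon
  obtain ⟨hs, ht⟩ := not_or.1 hcon
  obtain ⟨x, hx⟩ : ∃ x, π.hom t x ≠ 0 := by
    by_contra hx
    push Not at hx
    exact ht (by ext x; simpa using hx x)
  have := h.dense_orbit hx (LinearMap.ker (π.hom s : π.H →ₗ[ℂ] π.H))
    (π.hom s).isClosed_ker (fun a => by
      have := congrArg (fun T : π.H →L[ℂ] π.H => T x) (hst a)
      simpa [mul_assoc] using this)
  refine hs ?_
  ext z
  have hz : z ∈ LinearMap.ker (π.hom s : π.H →ₗ[ℂ] π.H) := this ▸ Submodule.mem_top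
  simpa using hz

end Rep

/-! ### The spectrum and the Jacobson topology -/

/-- Irreducible representations of `A`.  Every irreducible representation is cyclic, so that its
Hilbert space has a copy in the universe of `A`. -/
abbrev Irrep (A : Type u) [NonUnitalCStarAlgebra A] : Type (u + 1) :=
  {π : Rep.{u, u} A // π.IsIrreducible}

instance Irrep.setoid (A : Type u) [NonUnitalCStarAlgebra A] : Setoid (Irrep A) where
  r π ρ := π.1.Equivalent ρ.1
  iseqv :=
    { refl := fun π => ⟨LinearIsometryEquiv.refl ℂ _, fun _ _ => rfl⟩
      symm := fun {π ρ} ⟨U, hU⟩ => ⟨U.symm, fun a x => by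
        rw [LinearIsometryEquiv.symm_apply_eq, hU, LinearIsometryEquiv.apply_symm_apply]⟩
      trans := fun {π ρ σ} ⟨U, hU⟩ ⟨V, hV⟩ => ⟨U.trans V, fun a x => by
        simp [hU, hV]⟩ }

/-- The spectrum of `A`: unitary equivalence classes of irreducible representations. -/
def Spectrum (A : Type u) [NonUnitalCStarAlgebra A] : Type (u + 1) :=
  Quotient (Irrep.setoid A)

/-- The class of an irreducible representation. -/
def Irrep.cls (π : Irrep A) : Spectrum A := Quotient.mk _ π

/-- The common kernel of the representations in a class. -/
def Spectrum.ker (x : Spectrum A) : ClosedIdeal A :=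
  Quotient.lift (fun π : Irrep A => π.1.ker) (by
    rintro π ρ ⟨U, hU⟩
    refine SetLike.ext fun a => ?_
    change π.1.hom a = 0 ↔ ρ.1.hom a = 0
    constructor
    · intro h
      ext y
      have := hU a (U.symm y)
      simpa [h] using this.symm
    · intro h
      ext y
      have := hU a y
      simpa [h] using this) x

/-- The set of primitive ideals: kernels of irreducible representations. -/
def Prim (A : Type u) [NonUnitalCStarAlgebra A] : Type u :=
  {P : ClosedIdeal A // ∃ π : Irrep A, P = π.1.ker}

/-- The hull of `S`: the set of primitive ideals containing `S`. -/
def hull (S : Set A) : Set (Prim A) := {P | S ⊆ P.1}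

/-- The Jacobson (hull-kernel) topology: the closed sets are exactly the hulls. -/
instance Prim.topologicalSpace : TopologicalSpace (Prim A) :=
  TopologicalSpace.ofClosed (Set.range (hull (A := A)))
    ⟨Set.univ, by
      rw [Set.eq_empty_iff_forall_notMem]
      rintro ⟨_, π, rfl⟩ hP
      refine π.2.1 ?_
      ext1 a
      exact hP (Set.mem_univ a)⟩
    (by
      intro C hC
      refine ⟨⋃₀ {S | hull S ∈ C}, ?_⟩
      ext P
      simp only [hull, Set.mem_ofPred_eq, Set.sUnion_subset_iff, Set.mem_sInter]
      constructor
      · intro h T hT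
        obtain ⟨S, rfl⟩ := hC hT
        exact h S hT
      · intro h S hS
        exact h _ hS)
    (by
      rintro _ ⟨S, rfl⟩ _ ⟨T, rfl⟩
      refine ⟨{x | ∃ s ∈ S, ∃ a, ∃ t ∈ T, x = s * a * t}, ?_⟩
      ext P
      simp only [hull, Set.mem_ofPred_eq, Set.mem_union]
      constructor
      · intro h
        by_contra hcon
        obtain ⟨h1, h2⟩ := not_or.1 hcon
        obtain ⟨s, hs, hs'⟩ := Set.not_subset.1 h1
        obtain ⟨t, ht, ht'⟩ := Set.not_subset.1 h2
        obtain ⟨P, π, rfl⟩ := P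
        rcases π.2.prime s t (fun a => h ⟨s, hs, a, t, ht, rfl⟩) with h3 | h3
        · exact hs' h3
        · exact ht' h3
      · rintro (h | h) _ ⟨s, hs, a, t, ht, rfl⟩
        · exact P.1.mul_mem_right' _ (P.1.mul_mem_right' _ (h hs))
        · exact P.1.mul_mem_left' _ (h ht))

/-- The canonical surjection of the spectrum onto the primitive ideals. -/
def Spectrum.toPrim (x : Spectrum A) : Prim A :=
  ⟨x.ker, Quotient.inductionOn x fun π => ⟨π, rfl⟩⟩

/-- The Jacobson topology on the spectrum. -/
instance Spectrum.topologicalSpace : TopologicalSpace (Spectrum A) :=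
  TopologicalSpace.induced Spectrum.toPrim inferInstance

/-- The set of classes `[π]` with `π(I) ≠ 0`. -/
def Spectrum.support (I : ClosedIdeal A) : Set (Spectrum A) :=
  {x | ∃ π : Irrep A, π.cls = x ∧ ∃ a ∈ I, π.1.hom a ≠ 0}

/-! ### Pure states and their GNS representations -/

section PureState

variable [PartialOrder A] [StarOrderedRing A]

/-- A positive linear functional on a C⋆-algebra, as a bounded linear functional. -/
def toCLM (f : A →ₚ[ℂ] ℂ) : A →L[ℂ] ℂ := ⟨f.toLinearMap, map_continuous f⟩

@[simp]
theorem toCLM_apply (f : A →ₚ[ℂ] ℂ) (a : A) : toCLM f a = f a := rfl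

/-- The GNS space of a positive functional has a vector implementing the functional. -/
theorem exists_cyclic (f : A →ₚ[ℂ] ℂ) :
    ∃ ξ : f.GNS, ‖ξ‖ ^ 2 ≤ ‖(toCLM f)‖ ∧
      (∀ a : A, f.gnsNonUnitalStarAlgHom a ξ = (f.toPreGNS a : f.GNS)) ∧
      ∀ a : A, f a = ⟪ξ, f.gnsNonUnitalStarAlgHom a ξ⟫_ℂ := by
  set C := ‖(toCLM f)‖ with hC
  have bound : ∀ a : A, ‖f a‖ ≤ Real.sqrt C * ‖f.toPreGNS a‖ := by
    intro a
    have hap := CStarAlgebra.increasingApproximateUnit A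
    have ht : Filter.Tendsto (fun e => ‖f (e * a)‖) (CStarAlgebra.approximateUnit A)
        (nhds ‖f a‖) :=
      ((map_continuous f).norm.tendsto a).comp (hap.tendsto_mul_right a)
    refine le_of_tendsto ht ?_
    filter_upwards [hap.eventually_norm, hap.eventually_star_eq] with e he hse
    have h1 : f (e * a) = ⟪f.toPreGNS e, f.toPreGNS a⟫_ℂ := by
      rw [PositiveLinearMap.preGNS_inner_def]
      simp [hse]
    rw [h1]
    refine (norm_inner_le_norm _ _).trans ?_
    gcongr
    rw [PositiveLinearMap.preGNS_norm_def]
    refine Real.sqrt_le_sqrt ?_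
    refine (Complex.re_le_norm _).trans ?_
    refine ((toCLM f).le_opNorm _).trans ?_
    rw [PositiveLinearMap.ofPreGNS_toPreGNS, CStarRing.norm_star_mul_self, ← hC]
    have : ‖e‖ * ‖e‖ ≤ 1 := mul_le_one₀ he (norm_nonneg _) he
    nlinarith [norm_nonneg (toCLM f)]
  let φ₀ : f.PreGNS →L[ℂ] ℂ :=
    LinearMap.mkContinuous (f.toLinearMap ∘ₗ f.ofPreGNS.toLinearMap) (Real.sqrt C)
      (fun a => bound (f.ofPreGNS a))
  let φ : f.GNS →L[ℂ] ℂ := φ₀.extend (UniformSpace.Completion.toComplL (𝕜 := ℂ) (E := f.PreGNS))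
  have hφ : ∀ a : A, φ (f.toPreGNS a : f.GNS) = f a := by
    intro a
    exact ContinuousLinearMap.extend_eq φ₀
      (UniformSpace.Completion.denseRange_coe)
      (UniformSpace.Completion.isUniformInducing_coe _) (f.toPreGNS a)
  have hφn : ‖φ‖ ≤ Real.sqrt C := by
    refine ContinuousLinearMap.opNorm_le_bound _ (Real.sqrt_nonneg _) fun x => ?_
    induction x using UniformSpace.Completion.induction_on with
    | hp => exact isClosed_le (by fun_prop) (by fun_prop)
    | ih x =>
      have := hφ (f.ofPreGNS x)
      rw [PositiveLinearMap.toPreGNS_ofPreGNS] at this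
      rw [this, UniformSpace.Completion.norm_coe]
      exact bound (f.ofPreGNS x)
  let ξ : f.GNS := (InnerProductSpace.toDual ℂ f.GNS).symm φ
  have hξ : ∀ x, ⟪ξ, x⟫_ℂ = φ x := fun x => InnerProductSpace.toDual_symm_apply
  have hcyc : ∀ a : A, f.gnsNonUnitalStarAlgHom a ξ = (f.toPreGNS a : f.GNS) := by
    intro a
    refine ext_inner_right ℂ fun x => ?_
    induction x using UniformSpace.Completion.induction_on with
    | hp => exact isClosed_eq (by fun_prop) (by fun_prop)
    | ih x =>
      rw [← ContinuousLinearMap.adjoint_inner_right, ← ContinuousLinearMap.star_eq_adjoint,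
        ← map_star, hξ, UniformSpace.Completion.inner_coe,
        PositiveLinearMap.preGNS_inner_def, PositiveLinearMap.gnsNonUnitalStarAlgHom_apply_coe]
      exact hφ (star a * f.ofPreGNS x)
  refine ⟨ξ, ?_, hcyc, fun a => ?_⟩
  · have : ‖ξ‖ ≤ Real.sqrt C := by
      simpa [ξ] using hφn
    calc ‖ξ‖ ^ 2 ≤ (Real.sqrt C) ^ 2 := by gcongr
      _ = C := Real.sq_sqrt (norm_nonneg _)
  · rw [hcyc, hξ, hφ]


variable (A) in
/-- Pure states: positive linear functionals `ω` of norm one such that every positive linear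
functional dominated by `ω` is `t • ω` for some `t ∈ [0, 1]`. -/
structure PureState where
  toFunctional : A →ₚ[ℂ] ℂ
  norm_eq_one : ‖toCLM toFunctional‖ = 1
  pure : ∀ ψ : A →ₚ[ℂ] ℂ, (∀ a, 0 ≤ a → ψ a ≤ toFunctional a) →
    ∃ t : ℝ, 0 ≤ t ∧ t ≤ 1 ∧ ∀ a, ψ a = t * toFunctional a

namespace PureState

/-- The weak⋆ uniform structure. -/
instance : UniformSpace (PureState A) :=
  UniformSpace.comap (fun (ω : PureState A) (a : A) => ω.toFunctional a) inferInstance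

/-- The GNS representation of a pure state. -/
def gns (ω : PureState A) : Rep.{u, u} A where
  H := ω.toFunctional.GNS
  hom := ω.toFunctional.gnsNonUnitalStarAlgHom

theorem exists_gns_vector (ω : PureState A) :
    ∃ ξ : ω.gns.H, ‖ξ‖ = 1 ∧ (Dense (Set.range fun a : A => ω.gns.hom a ξ)) ∧
      ∀ a : A, ω.toFunctional a = ⟪ξ, ω.gns.hom a ξ⟫_ℂ := by
  obtain ⟨ξ, h1, h2, h3⟩ := exists_cyclic ω.toFunctional
  refine ⟨ξ, ?_, ?_, h3⟩
  · rw [ω.norm_eq_one] at h1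
    have h4 : ‖toCLM ω.toFunctional‖ ≤ ‖ξ‖ ^ 2 := by
      refine ContinuousLinearMap.opNorm_le_bound _ (by positivity) fun a => ?_
      rw [toCLM_apply, h3]
      refine (norm_inner_le_norm _ _).trans ?_
      have h5 := (ω.gns.hom a).le_of_opNorm_le (NonUnitalStarAlgHom.norm_apply_le _ a) ξ
      refine (mul_le_mul_of_nonneg_left h5 (norm_nonneg (E := ω.gns.H) ξ)).trans (le_of_eq ?_)
      have h6 : ∀ r s : ℝ, r * (s * r) = r ^ 2 * s := fun r s => by ring
      exact h6 _ _
    rw [ω.norm_eq_one] at h4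
    have h7 : ‖ξ‖ ^ 2 = 1 := le_antisymm h1 h4
    exact (pow_eq_one_iff_of_nonneg (norm_nonneg _) two_ne_zero).1 h7
  · have : (Set.range fun a : A => ω.gns.hom a ξ) =
        Set.range ((↑) : ω.toFunctional.PreGNS → ω.toFunctional.GNS) := by
      ext x
      constructor
      · rintro ⟨a, rfl⟩
        exact ⟨_, (h2 a).symm⟩
      · rintro ⟨a, rfl⟩
        exact ⟨ω.toFunctional.ofPreGNS a, h2 _⟩
    rw [this]
    exact UniformSpace.Completion.denseRange_coe

/-- Every vector of a representation defines a positive functional. -/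
def vectorFunctional (π : Rep.{u, v} A) (x : π.H) : A →ₚ[ℂ] ℂ :=
  PositiveLinearMap.mk₀
    { toFun := fun a => ⟪x, π.hom a x⟫_ℂ
      map_add' := fun a b => by simp
      map_smul' := fun c a => by simp }
    (fun a ha => by
      obtain ⟨b, rfl⟩ := CStarAlgebra.nonneg_iff_eq_star_mul_self.1 ha
      simp only [map_mul, map_star, LinearMap.coe_mk, AddHom.coe_mk,
        mul_apply_eq_comp, ContinuousLinearMap.star_eq_adjoint,
        ContinuousLinearMap.adjoint_inner_right]
      rw [inner_self_eq_norm_sq_to_K]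
      positivity)

@[simp]
theorem vectorFunctional_apply (π : Rep.{u, v} A) (x : π.H) (a : A) :
    vectorFunctional π x a = ⟪x, π.hom a x⟫_ℂ := rfl

/-- The GNS representation of a pure state is irreducible. -/
theorem isIrreducible_gns (ω : PureState A) : ω.gns.IsIrreducible := by
  obtain ⟨ξ, hξ, hdense, hω⟩ := ω.exists_gns_vector
  constructor
  · intro h0
    have : toCLM ω.toFunctional = 0 := by
      ext a
      rw [toCLM_apply, hω, h0]
      simp
    have h1 := ω.norm_eq_one
    rw [this, norm_zero] at h1
    exact zero_ne_one h1
  · intro K hK hinv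
    have : CompleteSpace K := hK.completeSpace_coe
    have hinv' : ∀ (a : A), ∀ x ∈ Kᗮ, ω.gns.hom a x ∈ Kᗮ := by
      intro a x hx
      rw [Submodule.mem_orthogonal] at hx ⊢
      intro y hy
      rw [← ContinuousLinearMap.adjoint_inner_left, ← ContinuousLinearMap.star_eq_adjoint,
        ← map_star]
      exact hx _ (hinv _ y hy)
    obtain ⟨p, hp, q, hq, hpq⟩ := K.exists_add_mem_mem_orthogonal ξ
    have horth : ∀ a : A, ω.toFunctional a =
        ⟪p, ω.gns.hom a p⟫_ℂ + ⟪q, ω.gns.hom a q⟫_ℂ := by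
      intro a
      rw [hω, hpq, map_add, inner_add_left, inner_add_right, inner_add_right,
        (Submodule.mem_orthogonal _ _).1 (hinv' a q hq) p hp,
        (Submodule.mem_orthogonal' _ _).1 hq _ (hinv a p hp)]
      ring
    obtain ⟨t, -, -, ht⟩ := ω.pure (vectorFunctional ω.gns p) (fun a ha => by
      have h1 := (vectorFunctional ω.gns q).map_nonneg ha
      rw [vectorFunctional_apply] at h1
      rw [vectorFunctional_apply, horth]
      exact le_add_of_nonneg_right h1)
    have hpt : p = (t : ℂ) • ξ := by
      have h0 : p - (t : ℂ) • ξ = 0 := by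
        refine hdense.eq_zero_of_inner_left (𝕜 := ℂ) ?_
        rintro _ ⟨a, rfl⟩
        have h1 : ⟪p, ω.gns.hom a ξ⟫_ℂ = ⟪p, ω.gns.hom a p⟫_ℂ := by
          rw [hpq, map_add, inner_add_right,
            (Submodule.mem_orthogonal _ _).1 (hinv' a q hq) p hp, add_zero]
        have h2 := ht a
        rw [vectorFunctional_apply, hω, ← h1] at h2
        change ⟪p - (t : ℂ) • ξ, ω.gns.hom a ξ⟫_ℂ = 0
        rw [inner_sub_left, inner_smul_left, h2]
        simp
      exact sub_eq_zero.1 h0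
    by_cases ht0 : (t : ℂ) = 0
    · left
      have hξK : ξ ∈ Kᗮ := by
        rw [hpq, hpt, ht0, zero_smul, zero_add]
        exact hq
      have hall : Kᗮ = ⊤ := by
        refine top_le_iff.1 fun x _ => ?_
        have hx := hdense x
        refine K.isClosed_orthogonal.closure_subset_iff.2 ?_ hx
        rintro _ ⟨a, rfl⟩
        exact hinv' a ξ hξK
      exact (Submodule.orthogonal_eq_top_iff K).1 hall
    · right
      have hξK : ξ ∈ K := by
        have : ξ = (t : ℂ)⁻¹ • p := by rw [hpt, inv_smul_smul₀ ht0]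
        rw [this]
        exact K.smul_mem _ hp
      refine top_le_iff.1 fun x _ => ?_
      refine hK.closure_subset_iff.2 ?_ (hdense x)
      rintro _ ⟨a, rfl⟩
      exact hinv a ξ hξK

/-- The GNS representation of a pure state, as an irreducible representation. -/
def irrep (ω : PureState A) : Irrep A := ⟨ω.gns, ω.isIrreducible_gns⟩

/-- The natural projection of the pure states onto the spectrum. -/
def toSpectrum (ω : PureState A) : Spectrum A := ω.irrep.cls

/-- A pure state over the class of `π` is given by a unit vector in the space of `π`. -/
theorem exists_vector (ω : PureState A) (π : Irrep A) (h : ω.toSpectrum = π.cls) :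
    ∃ x : π.1.H, ‖x‖ = 1 ∧ ∀ a : A, ω.toFunctional a = ⟪x, π.1.hom a x⟫_ℂ := by
  obtain ⟨U, hU⟩ : ω.irrep.1.Equivalent π.1 := Quotient.exact h
  obtain ⟨ξ, hξ, -, hω⟩ := ω.exists_gns_vector
  refine ⟨U ξ, (U.norm_map ξ).trans hξ, fun a => ?_⟩
  rw [hω]
  exact ((congrArg (fun y => ⟪U ξ, y⟫_ℂ) (hU a ξ)).symm.trans (U.inner_map_map _ _)).symm

/-- A unit vector implementing `ω` in the space of `π`; it is unique up to a phase. -/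
def vector (ω : PureState A) (π : Irrep A) (h : ω.toSpectrum = π.cls) : π.1.H :=
  (ω.exists_vector π h).choose

theorem norm_vector (ω : PureState A) (π : Irrep A) (h : ω.toSpectrum = π.cls) :
    ‖ω.vector π h‖ = 1 := (ω.exists_vector π h).choose_spec.1

theorem vector_ne_zero (ω : PureState A) (π : Irrep A) (h : ω.toSpectrum = π.cls) :
    ω.vector π h ≠ 0 := by
  intro h0
  have := ω.norm_vector π h
  rw [h0, norm_zero] at this
  exact zero_ne_one this

/-- The identification of the fibre over the class of `π` with the projective space of `π`. -/
def toProj (π : Irrep A) (ω : {ω : PureState A // ω.toSpectrum = π.cls}) : Projectivization ℂ π.1.H :=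
  Projectivization.mk ℂ (ω.1.vector π ω.2) (ω.1.vector_ne_zero π ω.2)

end PureState

end PureState

/-! ### The Kähler structure of a projective Hilbert space -/

/-- A local holomorphic chart of `M` with values in a Hilbert space `V`, together with the local
expression of a Hermitian metric: `metric z` is the Hermitian form at the point with coordinate
`z`, and its real part is the Riemannian metric. -/
structure KahlerChart (M : Type v) where
  V : Type u
  [normed : NormedAddCommGroup V]
  [inner : InnerProductSpace ℂ V]
  [complete : CompleteSpace V]
  source : Set M
  coord : source → V
  metric : V → V → V → ℂ

/-- Pull back a chart. -/
def KahlerChart.comap {M : Type v} {N : Type w} (c : KahlerChart.{u} N) (f : M → N) :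
    KahlerChart.{u} M where
  V := c.V
  normed := c.normed
  inner := c.inner
  complete := c.complete
  source := f ⁻¹' c.source
  coord := fun m => c.coord ⟨f m.1, m.2⟩
  metric := c.metric

section Projective

variable (H : Type u) [NormedAddCommGroup H] [InnerProductSpace ℂ H] [CompleteSpace H]

/-- The affine chart `[x] ↦ x / ⟨h, x⟩ - h ∈ h^⊥` of the projective space at a unit vector `h`, with
the Fubini-Study metric, normalized so that the distance is `√2 arccos |⟨x, y⟩|`. -/
def affineChart (h : H) (_ : ‖h‖ = 1) : KahlerChart.{u} (Projectivization ℂ H) where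
  V := (Submodule.span ℂ {h})ᗮ
  source := {p | ⟪h, p.rep⟫_ℂ ≠ 0}
  coord := fun p => ⟨(⟪h, p.1.rep⟫_ℂ)⁻¹ • p.1.rep - h, by
    rw [Submodule.mem_orthogonal_singleton_iff_inner_right, inner_sub_right, inner_smul_right,
      inv_mul_cancel₀ p.2, inner_self_eq_norm_sq_to_K, ‹‖h‖ = 1›]
    simp⟩
  metric := fun z u v =>
    2 * ((1 + (‖z‖ : ℂ) ^ 2) * ⟪u, v⟫_ℂ - ⟪u, z⟫_ℂ * ⟪z, v⟫_ℂ) / (1 + (‖z‖ : ℂ) ^ 2) ^ 2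

variable {H} in
/-- The Kähler distance `√2 arccos |⟨x, y⟩|` of the projective space, for unit vectors `x`, `y`. -/
def projDist (p q : Projectivization ℂ H) : ℝ :=
  Real.sqrt 2 * Real.arccos (‖⟪p.rep, q.rep⟫_ℂ‖ / (‖p.rep‖ * ‖q.rep‖))

end Projective

/-! ### Bundles -/

/-- A bundle `p : E' → X'` with `E' ⊆ E` and `X' ⊆ X`, and with the structures carried by a uniform
Kähler bundle: a uniformity on the total space (which also gives its topology), a topology on the
base space, a distance function, and an atlas of Kähler charts on each fibre. -/
@[ext]
structure KahlerBundle (E : Type v) (X : Type w) where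
  total : Set E
  base : Set X
  proj : total → base
  uniformity : UniformSpace total
  baseTopology : TopologicalSpace base
  dist : total → total → ℝ
  atlas : ∀ x : base, Set (KahlerChart.{u} {e : total // proj e = x})

namespace KahlerBundle

variable {E : Type v} {X : Type w}

/-- The restriction of a bundle to a subset `U` of the base: the total space is the preimage of
`U`, and all the structures are inherited. -/
def restrict (K : KahlerBundle.{u} E X) (U : Set X) : KahlerBundle.{u} E X where
  total := {e | ∃ h : e ∈ K.total, (K.proj ⟨e, h⟩ : X) ∈ U}
  base := {x | x ∈ K.base ∧ x ∈ U}
  proj := fun e => ⟨K.proj ⟨e.1, e.2.fst⟩, (K.proj ⟨e.1, e.2.fst⟩).2, e.2.snd⟩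
  uniformity := UniformSpace.comap (fun e => (⟨e.1, e.2.fst⟩ : K.total)) K.uniformity
  baseTopology := TopologicalSpace.induced (fun x => (⟨x.1, x.2.1⟩ : K.base)) K.baseTopology
  dist := fun e e' => K.dist ⟨e.1, e.2.fst⟩ ⟨e'.1, e'.2.fst⟩
  atlas := fun x => (fun c => c.comap fun e =>
    ⟨⟨e.1.1, e.1.2.fst⟩, Subtype.ext (congrArg (fun y => y.1) e.2)⟩) '' K.atlas ⟨x.1, x.2.1⟩

end KahlerBundle

section UKB

variable (A) [PartialOrder A] [StarOrderedRing A]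

open Classical in
/-- The Kähler distance on the pure states. -/
def kahlerDist (ω ω' : PureState A) : ℝ :=
  if h : ω'.toSpectrum = ω.toSpectrum then
    projDist (PureState.toProj ω.irrep ⟨ω, rfl⟩) (PureState.toProj ω.irrep ⟨ω', h⟩)
  else 3

/-- The uniform Kähler bundle of a C⋆-algebra: the pure states over the spectrum, each fibre
carrying the Kähler structure of the projective space of a representation in the class. -/
def ukb : KahlerBundle.{u} (PureState A) (Spectrum A) where
  total := Set.univ
  base := Set.univ
  proj := fun ω => ⟨ω.1.toSpectrum, trivial⟩
  uniformity := inferInstance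
  baseTopology := inferInstance
  dist := fun ω ω' => kahlerDist A ω.1 ω'.1
  atlas := fun x => {c | ∃ (π : Irrep A) (hπ : π.cls = x.1) (h : π.1.H) (hh : ‖h‖ = 1),
    c = (affineChart π.1.H h hh).comap fun ω =>
      PureState.toProj π ⟨ω.1.1, (congrArg Subtype.val ω.2).trans hπ.symm⟩}

/-- Restrictions of the uniform Kähler bundle of `A` to open subsets of the spectrum. -/
def bunOpen : Set (KahlerBundle.{u} (PureState A) (Spectrum A)) :=
  {K | ∃ U : Set (Spectrum A), IsOpen U ∧ K = (ukb A).restrict U}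

/-- Restrictions of the uniform Kähler bundle of `A` to closed subsets of the spectrum. -/
def bunClosed : Set (KahlerBundle.{u} (PureState A) (Spectrum A)) :=
  {K | ∃ V : Set (Spectrum A), IsClosed V ∧ K = (ukb A).restrict V}

end UKB

/-! ### Quotient C⋆-algebras -/

/-- A C⋆-algebra `B` with a surjective ⋆-homomorphism `A → B`. -/
structure QuotientMap (A : Type u) [NonUnitalCStarAlgebra A] where
  B : Type u
  [inst : NonUnitalCStarAlgebra B]
  hom : A →⋆ₙₐ[ℂ] B
  surjective : Function.Surjective hom

attribute [instance] QuotientMap.inst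

/-- Two quotient maps are identified if they differ by a ⋆-isomorphism of the quotients. -/
instance QuotientMap.setoid (A : Type u) [NonUnitalCStarAlgebra A] : Setoid (QuotientMap A) where
  r p q := ∃ e : p.B ≃⋆ₐ[ℂ] q.B, ∀ a, e (p.hom a) = q.hom a
  iseqv :=
    { refl := fun p => ⟨StarAlgEquiv.refl ℂ p.B, fun _ => rfl⟩
      symm := fun {p q} ⟨e, he⟩ => ⟨e.symm, fun a => by
        rw [← he]
        exact e.symm_apply_apply _⟩
      trans := fun {p q r} ⟨e, he⟩ ⟨f, hf⟩ => ⟨e.trans f, fun a => by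
        rw [← hf, ← he]
        rfl⟩ }

/-- The quotient C⋆-algebras of `A`. -/
def QuotientAlgebra (A : Type u) [NonUnitalCStarAlgebra A] : Type (u + 1) :=
  Quotient (QuotientMap.setoid A)

/-- The ideal `I` of a quotient C⋆-algebra `A / I`: the kernel of the quotient map. -/
def QuotientAlgebra.ideal (Q : QuotientAlgebra A) : ClosedIdeal A :=
  Quotient.lift (fun q : QuotientMap A => kerHom q.hom) (by
    intro p q hpq
    obtain ⟨e, he⟩ : ∃ e : p.B ≃⋆ₐ[ℂ] q.B, ∀ a, e (p.hom a) = q.hom a := hpq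
    refine SetLike.ext fun a => ?_
    rw [mem_kerHom, mem_kerHom, ← he]
    exact (EmbeddingLike.map_eq_zero_iff (f := e)).symm) Q

end

end CStarUKB

/-!
Everything rests on two facts about a closed two-sided ideal `I`.

* `A / I` is a C⋆-algebra with the quotient norm (the `NonUnitalCStarAlgebra` instance on
  `ClosedIdeal.Quot`). The C⋆-identity `‖a + I‖² ≤ ‖a⋆ a + I‖` is
  `ClosedIdeal.exists_norm_add_sq_le`; it uses elements `e ∈ I`, obtained by functional calculus,
  that are approximate right units for a given element of `I`
  (`ClosedIdeal.exists_approx_right_unit`). The same elements show that `I` is self-adjoint. Two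
  quotient maps with the same kernel are isomorphic for algebraic reasons
  (`QuotientAlgebra.ideal_injective`), so that quotient C⋆-algebras are the same as closed ideals.

* `I` is the intersection of the kernels of the irreducible representations that vanish on it
  (`Spectrum.mem_iff_of_notMem_support`). In view of the quotient `A / I` this amounts to the fact
  that pure states detect nonzero positive elements `c` (`PureState.exists_apply_ne_zero`): the
  Hahn-Banach theorem gives a positive functional that is positive at `c`, and the existence of
  extreme points gives a pure one, as the positive functionals of norm at most one form a compact
  convex set in which the nonzero extreme points are pure. Their purity depends on the additivity
  of the norm on positive functionals (`norm_toCLM_add`).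

By the second fact `I` is determined by its support, and also equals the kernel of the direct sum
over the complement of the support. The closed sets of the Jacobson topology are the hulls of
subsets `S` of `A`, and `S` can be replaced by the kernel of its hull, which is a closed ideal; so
every open set is a support (`Spectrum.support_kernel_compl`). Finally, a restriction of the bundle
remembers its base, hence the subset of the spectrum to which the bundle was restricted.
-/

namespace CStarUKB

universe u v w

noncomputable section

open scoped ComplexOrder InnerProductSpace CStarAlgebra

/-! ### Approximate units in closed ideals -/

namespace ClosedIdeal

variable {A : Type u} [NonUnitalCStarAlgebra A] (I : ClosedIdeal A)

theorem mul_mem_left (a : A) {b : A} (hb : b ∈ I) : a * b ∈ I := I.mul_mem_left' a hb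

theorem mul_mem_right {a : A} (b : A) (ha : a ∈ I) : a * b ∈ I := I.mul_mem_right' b ha

/-- The function `t ↦ N t² / (1 + N t²)`, which is close to `1` where `N t²` is large. It is written
as a product of two functions vanishing at `0`, so that its value at a self-adjoint element `b` is a
multiple of `b`. -/
def cutoff (N t : ℝ) : ℝ := t * (N * t / (1 + N * t ^ 2))

theorem continuous_cutoff_aux {N : ℝ} (hN : 0 < N) : Continuous fun t : ℝ => N * t / (1 + N * t ^ 2) :=
  Continuous.div (by fun_prop) (by fun_prop) fun t => by positivity

theorem continuous_cutoff {N : ℝ} (hN : 0 < N) : Continuous (cutoff N) :=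
  continuous_id.mul (continuous_cutoff_aux hN)

theorem one_sub_cutoff {N : ℝ} (hN : 0 < N) (t : ℝ) : 1 - cutoff N t = (1 + N * t ^ 2)⁻¹ := by
  have : 1 + N * t ^ 2 ≠ 0 := by positivity
  simp only [cutoff]
  field_simp
  ring

theorem cutoff_nonneg {N : ℝ} (hN : 0 < N) (t : ℝ) : 0 ≤ cutoff N t := by
  have : cutoff N t = N * t ^ 2 / (1 + N * t ^ 2) := by
    simp only [cutoff]
    ring
  rw [this]
  positivity

theorem cutoff_le_one {N : ℝ} (hN : 0 < N) (t : ℝ) : cutoff N t ≤ 1 := by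
  have h : 0 ≤ (1 + N * t ^ 2)⁻¹ := by positivity
  rw [← one_sub_cutoff hN] at h
  linarith

theorem cutoff_zero (N : ℝ) : cutoff N 0 = 0 := by simp [cutoff]

theorem abs_mul_one_sub_cutoff_sq_le {ε : ℝ} (hε : 0 < ε) (t : ℝ) :
    |t * (1 - cutoff (ε ^ 4)⁻¹ t) ^ 2| ≤ ε ^ 2 := by
  rw [one_sub_cutoff (by positivity)]
  have h0 : 0 < 1 + (ε ^ 4)⁻¹ * t ^ 2 := by positivity
  -- the inequality of the arithmetic and geometric means
  have h4 : |t| ≤ ε ^ 2 * (1 + (ε ^ 4)⁻¹ * t ^ 2) := by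
    have h5 : ε ^ 2 * (1 + (ε ^ 4)⁻¹ * t ^ 2) = ε ^ 2 + |t| ^ 2 / ε ^ 2 := by
      rw [sq_abs]
      field_simp
    have h6 : 0 ≤ (ε ^ 2 - |t|) ^ 2 / ε ^ 2 := by positivity
    have h7 : (ε ^ 2 - |t|) ^ 2 / ε ^ 2 = ε ^ 2 - 2 * |t| + |t| ^ 2 / ε ^ 2 := by
      field_simp
      ring
    have := abs_nonneg t
    linarith
  have h8 : (1 + (ε ^ 4)⁻¹ * t ^ 2)⁻¹ ≤ 1 :=
    inv_le_one_of_one_le₀ (le_add_of_nonneg_right (by positivity))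
  have h9 : 0 < (1 + (ε ^ 4)⁻¹ * t ^ 2)⁻¹ := inv_pos.2 h0
  rw [abs_mul, abs_of_pos (by positivity : 0 < (1 + (ε ^ 4)⁻¹ * t ^ 2)⁻¹ ^ 2)]
  calc |t| * (1 + (ε ^ 4)⁻¹ * t ^ 2)⁻¹ ^ 2 ≤ |t| * (1 + (ε ^ 4)⁻¹ * t ^ 2)⁻¹ := by
        gcongr
        nlinarith
    _ ≤ (ε ^ 2 * (1 + (ε ^ 4)⁻¹ * t ^ 2)) * (1 + (ε ^ 4)⁻¹ * t ^ 2)⁻¹ := by gcongr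
    _ = ε ^ 2 := by rw [mul_assoc, mul_inv_cancel₀ h0.ne', mul_one]

theorem cfcₙ_cutoff_mem {b : A} (hb : b ∈ I) (hbs : IsSelfAdjoint b) {N : ℝ} (hN : 0 < N) :
    cfcₙ (cutoff N) b ∈ I := by
  have : cfcₙ (cutoff N) b = b * cfcₙ (fun t : ℝ => N * t / (1 + N * t ^ 2)) b := by
    unfold cutoff
    rw [cfcₙ_mul (fun t => t) _ b (by fun_prop) rfl (continuous_cutoff_aux hN).continuousOn
      (by simp), cfcₙ_id' ℝ b hbs]
  rw [this]
  exact I.mul_mem_right _ hb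

/-- For `e = cutoff N b`, the operator `1 - e` of the unitization has norm at most one. -/
theorem norm_sub_mul_cfcₙ_cutoff_le (b : A) {N : ℝ} (hN : 0 < N) (y : A) :
    ‖y - y * cfcₙ (cutoff N) b‖ ≤ ‖y‖ := by
  let _ := CStarAlgebra.spectralOrder A
  have _ := CStarAlgebra.spectralOrderedRing A
  have hfc := continuous_cutoff hN
  have hf0 := cutoff_zero N
  set e := cfcₙ (cutoff N) b with he
  have hes : IsSelfAdjoint e := cfcₙ_predicate _ b
  have hk : 0 ≤ e + e - e * e := by
    have : e + e - e * e =
        cfcₙ (fun t => cutoff N t + cutoff N t - cutoff N t * cutoff N t) b := by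
      rw [cfcₙ_sub (fun t => cutoff N t + cutoff N t) (fun t => cutoff N t * cutoff N t) b
        (by fun_prop) (by simp [hf0]) (by fun_prop) (by simp [hf0]),
        cfcₙ_add (cutoff N) (cutoff N) b hfc.continuousOn hf0 hfc.continuousOn hf0,
        cfcₙ_mul (cutoff N) (cutoff N) b hfc.continuousOn hf0 hfc.continuousOn hf0]
    rw [this]
    refine cfcₙ_nonneg fun t _ => ?_
    have h1 := cutoff_nonneg hN t
    have h2 := cutoff_le_one hN t
    nlinarith
  have h1 : (y - y * e) * star (y - y * e) = y * star y - y * (e + e - e * e) * star y := by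
    rw [star_sub, star_mul, hes.star_eq]
    noncomm_ring
  have h2 : ‖(y - y * e) * star (y - y * e)‖ ≤ ‖y * star y‖ := by
    refine CStarAlgebra.norm_le_norm_of_nonneg_of_le (mul_star_self_nonneg _) ?_
    rw [h1]
    exact sub_le_self _ (star_right_conjugate_nonneg hk y)
  rw [CStarRing.norm_self_mul_star, CStarRing.norm_self_mul_star, ← sq, ← sq] at h2
  exact (sq_le_sq₀ (norm_nonneg _) (norm_nonneg _)).1 h2

/-- With `b = x⋆ x` and `e = cutoff N b`, the C⋆-identity gives
`‖x (1 - e)‖² = ‖b (1 - e)²‖`. -/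
theorem norm_sub_mul_cfcₙ_cutoff_star_mul_self_le (x : A) {ε : ℝ} (hε : 0 < ε) :
    ‖x - x * cfcₙ (cutoff (ε ^ 4)⁻¹) (star x * x)‖ ≤ ε := by
  set f := cutoff (ε ^ 4)⁻¹ with hf
  set b := star x * x with hb
  have hbs : IsSelfAdjoint b := IsSelfAdjoint.star_mul_self x
  have hfc : Continuous f := continuous_cutoff (by positivity)
  have hf0 : f 0 = 0 := cutoff_zero _
  set e := cfcₙ f b with he
  have hes : IsSelfAdjoint e := cfcₙ_predicate f b
  have h3 : cfcₙ (fun t => t - t * f t) b = b - b * e := by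
    rw [cfcₙ_sub (fun t => t) (fun t => t * f t) b (by fun_prop) rfl (by fun_prop)
      (by simp), cfcₙ_mul (fun t => t) f b (by fun_prop) rfl hfc.continuousOn hf0, cfcₙ_id' ℝ b]
  have h1 : star (x - x * e) * (x - x * e) =
      cfcₙ (fun t => (t - t * f t) - f t * (t - t * f t)) b := by
    rw [cfcₙ_sub (fun t => t - t * f t) (fun t => f t * (t - t * f t)) b (by fun_prop) (by simp)
      (by fun_prop) (by simp), cfcₙ_mul f (fun t => t - t * f t) b hfc.continuousOn hf0
      (by fun_prop) (by simp), h3, ← he, star_sub, star_mul, hes.star_eq, hb]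
    noncomm_ring
  have h2 : ‖star (x - x * e) * (x - x * e)‖ ≤ ε ^ 2 := by
    rw [h1]
    refine norm_cfcₙ_le fun t _ => ?_
    have h3 : (t - t * f t) - f t * (t - t * f t) = t * (1 - f t) ^ 2 := by ring
    rw [h3, Real.norm_eq_abs]
    exact abs_mul_one_sub_cutoff_sq_le hε t
  rw [CStarRing.norm_star_mul_self, ← sq] at h2
  exact (sq_le_sq₀ (norm_nonneg _) hε.le).1 h2

/-- Approximate right units: only `x⋆ x ∈ I` is assumed, so that the lemma also applies to the
adjoint of an element of `I`. -/
theorem exists_approx_right_unit {x : A} (hx : star x * x ∈ I) {ε : ℝ} (hε : 0 < ε) :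
    ∃ e ∈ I, IsSelfAdjoint e ∧ (∀ y : A, ‖y - y * e‖ ≤ ‖y‖) ∧ ‖x - x * e‖ ≤ ε :=
  ⟨cfcₙ (cutoff (ε ^ 4)⁻¹) (star x * x),
    I.cfcₙ_cutoff_mem hx (.star_mul_self x) (by positivity), cfcₙ_predicate _ _,
    norm_sub_mul_cfcₙ_cutoff_le _ (by positivity),
    norm_sub_mul_cfcₙ_cutoff_star_mul_self_le x hε⟩

/-- Closed two-sided ideals are self-adjoint. -/
theorem star_mem {x : A} (hx : x ∈ I) : star x ∈ I := by
  have hcl : IsClosed (I : Set A) := I.isClosed'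
  refine hcl.closure_subset (Metric.mem_closure_iff.2 fun ε hε => ?_)
  obtain ⟨e, he, -, -, h⟩ := I.exists_approx_right_unit (x := star x)
    (by rw [star_star]; exact I.mul_mem_right _ hx) (half_pos hε)
  refine ⟨star x * e, I.mul_mem_left _ he, ?_⟩
  rw [dist_eq_norm]
  linarith

/-- The inequality behind the C⋆-identity of the quotient norm. The element `-j` is `a e` for an
approximate right unit `e` of `i`. -/
theorem exists_norm_add_sq_le (a : A) {i : A} (hi : i ∈ I) {ε : ℝ} (hε : 0 < ε) :
    ∃ j ∈ I, ‖a + j‖ ^ 2 ≤ ‖star a * a + i‖ + ε := by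
  obtain ⟨e, he, hes, hc, h⟩ := I.exists_approx_right_unit (x := i) (I.mul_mem_left _ hi) hε
  have hc' : ∀ y : A, ‖y - e * y‖ ≤ ‖y‖ := fun y => by
    have := hc (star y)
    rwa [← norm_star, star_sub, star_mul, star_star, hes.star_eq, norm_star] at this
  refine ⟨-(a * e), I.neg_mem (I.mul_mem_left a he), ?_⟩
  set c := star a * a + i with hcdef
  have h1 : star (a + -(a * e)) * (a + -(a * e)) =
      ((c - c * e) - e * (c - c * e)) - ((i - i * e) - e * (i - i * e)) := by
    rw [hcdef, star_add, star_neg, star_mul, hes.star_eq]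
    noncomm_ring
  rw [sq, ← CStarRing.norm_star_mul_self, h1]
  refine (norm_sub_le _ _).trans (add_le_add ?_ ?_)
  · exact (hc' _).trans (hc _)
  · exact (hc' _).trans h

/-! ### Quotient C⋆-algebras -/

/-- The quotient `A / I`, as a Banach space with the quotient norm. -/
def Quot : Type u := A ⧸ I.toSubmodule

instance : IsClosed (I.toSubmodule : Set A) := I.isClosed'

namespace Quot

instance : NormedAddCommGroup I.Quot := inferInstanceAs (NormedAddCommGroup (A ⧸ I.toSubmodule))

instance : NormedSpace ℂ I.Quot := inferInstanceAs (NormedSpace ℂ (A ⧸ I.toSubmodule))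

instance : CompleteSpace I.Quot := inferInstanceAs (CompleteSpace (A ⧸ I.toSubmodule))

/-- The quotient map `A → A / I`. -/
def mk : A →ₗ[ℂ] I.Quot := I.toSubmodule.mkQ

variable {I}

theorem mk_surjective : Function.Surjective (mk I) := I.toSubmodule.mkQ_surjective

theorem mk_eq_mk {a b : A} : mk I a = mk I b ↔ a - b ∈ I :=
  Submodule.Quotient.eq I.toSubmodule

theorem mk_eq_zero {a : A} : mk I a = 0 ↔ a ∈ I := Submodule.Quotient.mk_eq_zero I.toSubmodule

theorem norm_mk_le (a : A) : ‖mk I a‖ ≤ ‖a‖ := Submodule.Quotient.norm_mk_le I.toSubmodule a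

theorem exists_norm_lt {x : I.Quot} {r : ℝ} (h : ‖x‖ < r) : ∃ a, mk I a = x ∧ ‖a‖ < r := by
  obtain ⟨a, ha, h'⟩ := Submodule.Quotient.norm_mk_lt (S := I.toSubmodule) x (sub_pos.2 h)
  exact ⟨a, ha, h'.trans_eq (add_sub_cancel _ _)⟩

instance : Mul I.Quot where
  mul := Quotient.map₂ (· * ·) fun a b hab c d hcd => by
    have hab' : a - b ∈ I := (Submodule.quotientRel_def _).1 hab
    have hcd' : c - d ∈ I := (Submodule.quotientRel_def _).1 hcd
    refine (Submodule.quotientRel_def _).2 (?_ : a * c - b * d ∈ I)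
    have : a * c - b * d = (a - b) * c + b * (c - d) := by noncomm_ring
    rw [this]
    exact I.add_mem (I.mul_mem_right _ hab') (I.mul_mem_left _ hcd')

instance : Star I.Quot where
  star := Quotient.map star fun a b hab => by
    have hab' : a - b ∈ I := (Submodule.quotientRel_def _).1 hab
    refine (Submodule.quotientRel_def _).2 (?_ : star a - star b ∈ I)
    rw [← star_sub]
    exact I.star_mem hab'

theorem mk_mul (a b : A) : mk I (a * b) = mk I a * mk I b := rfl

theorem mk_star (a : A) : mk I (star a) = star (mk I a) := rfl

instance : NonUnitalNormedRing I.Quot where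
  __ := (inferInstance : NormedAddCommGroup I.Quot)
  left_distrib x y z := by
    obtain ⟨a, rfl⟩ := mk_surjective x
    obtain ⟨b, rfl⟩ := mk_surjective y
    obtain ⟨c, rfl⟩ := mk_surjective z
    simp only [← mk_mul, ← map_add, mul_add]
  right_distrib x y z := by
    obtain ⟨a, rfl⟩ := mk_surjective x
    obtain ⟨b, rfl⟩ := mk_surjective y
    obtain ⟨c, rfl⟩ := mk_surjective z
    simp only [← mk_mul, ← map_add, add_mul]
  zero_mul x := by
    obtain ⟨a, rfl⟩ := mk_surjective x
    rw [← map_zero (mk I), ← mk_mul, zero_mul]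
  mul_zero x := by
    obtain ⟨a, rfl⟩ := mk_surjective x
    rw [← map_zero (mk I), ← mk_mul, mul_zero]
  mul_assoc x y z := by
    obtain ⟨a, rfl⟩ := mk_surjective x
    obtain ⟨b, rfl⟩ := mk_surjective y
    obtain ⟨c, rfl⟩ := mk_surjective z
    simp only [← mk_mul, mul_assoc]
  norm_mul_le x y := by
    refine le_mul_of_forall_lt₀ fun r hr s hs => ?_
    obtain ⟨a, rfl, ha⟩ := exists_norm_lt hr
    obtain ⟨b, rfl, hb⟩ := exists_norm_lt hs
    rw [← mk_mul]
    exact (norm_mk_le _).trans ((norm_mul_le a b).trans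
      (mul_le_mul ha.le hb.le (norm_nonneg _) ((norm_nonneg _).trans ha.le)))

instance : StarRing I.Quot where
  star_involutive x := by
    obtain ⟨a, rfl⟩ := mk_surjective x
    rw [← mk_star, ← mk_star, star_star]
  star_mul x y := by
    obtain ⟨a, rfl⟩ := mk_surjective x
    obtain ⟨b, rfl⟩ := mk_surjective y
    simp only [← mk_star, ← mk_mul, star_mul]
  star_add x y := by
    obtain ⟨a, rfl⟩ := mk_surjective x
    obtain ⟨b, rfl⟩ := mk_surjective y
    simp only [← mk_star, ← map_add, star_add]

instance : CStarRing I.Quot where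
  norm_mul_self_le x := by
    obtain ⟨a, rfl⟩ := mk_surjective x
    refine le_of_forall_pos_le_add fun ε hε => ?_
    obtain ⟨b, hb, hlt⟩ := exists_norm_lt (lt_add_of_pos_right ‖star (mk I a) * mk I a‖
      (half_pos hε))
    rw [← mk_star, ← mk_mul, mk_eq_mk] at hb
    obtain ⟨j, hj, h⟩ := I.exists_norm_add_sq_le a hb (half_pos hε)
    rw [add_sub_cancel] at h
    have h1 : ‖mk I a‖ ≤ ‖a + j‖ := by
      have : mk I a = mk I (a + j) := by
        rw [map_add, mk_eq_zero.2 hj, add_zero]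
      rw [this]
      exact norm_mk_le _
    calc ‖mk I a‖ * ‖mk I a‖ ≤ ‖a + j‖ * ‖a + j‖ := by gcongr
      _ ≤ _ := by linarith

instance : IsScalarTower ℂ I.Quot I.Quot where
  smul_assoc c x y := by
    obtain ⟨a, rfl⟩ := mk_surjective x
    obtain ⟨b, rfl⟩ := mk_surjective y
    simp only [smul_eq_mul, ← mk_mul, ← map_smul, smul_mul_assoc]

instance : SMulCommClass ℂ I.Quot I.Quot where
  smul_comm c x y := by
    obtain ⟨a, rfl⟩ := mk_surjective x
    obtain ⟨b, rfl⟩ := mk_surjective y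
    simp only [smul_eq_mul, ← mk_mul, ← map_smul, mul_smul_comm]

instance : StarModule ℂ I.Quot where
  star_smul c x := by
    obtain ⟨a, rfl⟩ := mk_surjective x
    simp only [← mk_star, ← map_smul, star_smul]

/-- The quotient of a C⋆-algebra by a closed two-sided ideal is a C⋆-algebra. -/
instance : NonUnitalCStarAlgebra I.Quot where

variable (I) in
/-- The quotient map `A → A / I`, as a ⋆-homomorphism. -/
def mkHom : A →⋆ₙₐ[ℂ] I.Quot where
  __ := mk I
  map_zero' := map_zero (mk I)
  map_mul' := mk_mul
  map_star' := mk_star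

theorem mkHom_surjective : Function.Surjective (mkHom I) := mk_surjective

theorem mkHom_eq_zero {a : A} : mkHom I a = 0 ↔ a ∈ I := mk_eq_zero

end Quot

end ClosedIdeal

/-- Two quotients with the same ideal are isomorphic: the isomorphism sends `p a` to `q a`. -/
theorem QuotientAlgebra.ideal_injective {A : Type u} [NonUnitalCStarAlgebra A] :
    Function.Injective (QuotientAlgebra.ideal (A := A)) := by
  intro P Q
  induction P using Quotient.inductionOn with | _ p
  induction Q using Quotient.inductionOn with | _ q
  intro h
  have hker : ∀ a, p.hom a = 0 ↔ q.hom a = 0 := fun a => by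
    change kerHom p.hom = kerHom q.hom at h
    rw [← mem_kerHom, ← mem_kerHom, h]
  have heq : ∀ a b, p.hom a = p.hom b ↔ q.hom a = q.hom b := fun a b => by
    rw [← sub_eq_zero, ← map_sub, hker, map_sub, sub_eq_zero]
  choose s hs using p.surjective
  choose t ht using q.surjective
  have hst : ∀ a, q.hom (s (p.hom a)) = q.hom a := fun a => (heq _ _).1 (hs _)
  have hts : ∀ a, p.hom (t (q.hom a)) = p.hom a := fun a => (heq _ _).2 (ht _)
  refine Quotient.sound ⟨
    { toFun := fun x => q.hom (s x)
      invFun := fun y => p.hom (t y)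
      left_inv := fun x => by
        obtain ⟨a, rfl⟩ := p.surjective x
        change p.hom (t (q.hom (s (p.hom a)))) = p.hom a
        rw [hst, hts]
      right_inv := fun y => by
        obtain ⟨a, rfl⟩ := q.surjective y
        change q.hom (s (p.hom (t (q.hom a)))) = q.hom a
        rw [hts, hst]
      map_mul' := fun x y => by
        obtain ⟨a, rfl⟩ := p.surjective x
        obtain ⟨b, rfl⟩ := p.surjective y
        rw [← map_mul, hst, hst, hst, map_mul]
      map_add' := fun x y => by
        obtain ⟨a, rfl⟩ := p.surjective x
        obtain ⟨b, rfl⟩ := p.surjective y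
        rw [← map_add, hst, hst, hst, map_add]
      map_star' := fun x => by
        obtain ⟨a, rfl⟩ := p.surjective x
        rw [← map_star, hst, hst, map_star]
      map_smul' := fun c x => by
        obtain ⟨a, rfl⟩ := p.surjective x
        rw [← map_smul, hst, hst, map_smul] }, hst⟩

theorem QuotientAlgebra.exists_ideal_eq {A : Type u} [NonUnitalCStarAlgebra A]
    (I : ClosedIdeal A) : ∃ Q : QuotientAlgebra A, Q.ideal = I :=
  ⟨Quotient.mk _ ⟨I.Quot, ClosedIdeal.Quot.mkHom I, ClosedIdeal.Quot.mkHom_surjective⟩,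
    SetLike.ext fun _ => ClosedIdeal.Quot.mkHom_eq_zero⟩

/-! ### Existence of pure states -/

section States

variable {A : Type u} [NonUnitalCStarAlgebra A] [PartialOrder A] [StarOrderedRing A]

open Filter Topology

/-- Along the canonical approximate unit, `f (e²)` tends to the norm of `f`. -/
theorem tendsto_mul_self_approximateUnit (f : A →ₚ[ℂ] ℂ) :
    Tendsto (fun e => (f (e * e)).re) (CStarAlgebra.approximateUnit A) (𝓝 ‖toCLM f‖) := by
  have hap := CStarAlgebra.increasingApproximateUnit A
  have hnn : ∀ e, IsSelfAdjoint e → 0 ≤ (f (e * e)).re := fun e he => by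
    have h := f.map_nonneg (star_mul_self_nonneg e)
    rw [he.star_eq] at h
    exact (Complex.nonneg_iff.1 h).1
  set N := ‖toCLM f‖ with hN
  refine tendsto_order.2 ⟨fun b hb => ?_, fun b hb => ?_⟩
  · rcases lt_or_ge b 0 with hb0 | hb0
    · filter_upwards [hap.eventually_isSelfAdjoint] with e he
      exact hb0.trans_le (hnn e he)
    · have hN0 : 0 < N := hb0.trans_lt hb
      obtain ⟨a, ha, hra⟩ := (toCLM f).exists_lt_apply_of_lt_opNorm
        (show (b + N) / 2 < ‖toCLM f‖ by linarith)
      have ht : Tendsto (fun e => ‖f (e * a)‖) (CStarAlgebra.approximateUnit A) (𝓝 ‖f a‖) :=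
        ((map_continuous f).norm.tendsto a).comp (hap.tendsto_mul_right a)
      filter_upwards [ht.eventually (lt_mem_nhds hra), hap.eventually_isSelfAdjoint] with e h1 he
      -- the Cauchy-Schwarz inequality
      have h2 : ‖f (e * a)‖ ^ 2 ≤ (f (e * e)).re * N := by
        have h3 : f (e * a) = ⟪f.toPreGNS e, f.toPreGNS a⟫_ℂ := by
          rw [PositiveLinearMap.preGNS_inner_def]
          simp [he.star_eq]
        have h4 : ‖f.toPreGNS e‖ ^ 2 = (f (e * e)).re := by
          have := congrArg Complex.re (f.preGNS_norm_sq (f.toPreGNS e))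
          rw [PositiveLinearMap.ofPreGNS_toPreGNS, he.star_eq] at this
          rw [← this, ← Complex.ofReal_pow, Complex.ofReal_re]
        have h5 : ‖f.toPreGNS a‖ ^ 2 ≤ N := by
          have := congrArg Complex.re (f.preGNS_norm_sq (f.toPreGNS a))
          rw [PositiveLinearMap.ofPreGNS_toPreGNS, ← Complex.ofReal_pow, Complex.ofReal_re] at this
          rw [this]
          refine (Complex.re_le_norm _).trans (((toCLM f).le_opNorm _).trans ?_)
          rw [CStarRing.norm_star_mul_self]
          exact mul_le_of_le_one_right hN0.le (mul_le_one₀ ha.le (norm_nonneg _) ha.le)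
        calc ‖f (e * a)‖ ^ 2 ≤ (‖f.toPreGNS e‖ * ‖f.toPreGNS a‖) ^ 2 := by
              rw [h3]
              gcongr
              exact norm_inner_le_norm _ _
          _ = (f (e * e)).re * ‖f.toPreGNS a‖ ^ 2 := by rw [mul_pow, h4]
          _ ≤ _ := mul_le_mul_of_nonneg_left h5 (hnn e he)
      have h6 : ((b + N) / 2) ^ 2 < ‖f (e * a)‖ ^ 2 := by
        gcongr
      have h7 : b * N < (f (e * e)).re * N := by nlinarith [sq_nonneg (b - N)]
      exact lt_of_mul_lt_mul_right h7 hN0.le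
  · filter_upwards [hap.eventually_norm] with e he
    refine lt_of_le_of_lt ?_ hb
    refine (Complex.re_le_norm _).trans (((toCLM f).le_opNorm _).trans ?_)
    refine mul_le_of_le_one_right (norm_nonneg _) ((norm_mul_le _ _).trans ?_)
    exact mul_le_one₀ he (norm_nonneg _) he

/-- The norm is additive on positive functionals. -/
theorem norm_toCLM_add {f g h : A →ₚ[ℂ] ℂ} (hf : ∀ a, f a = g a + h a) :
    ‖toCLM f‖ = ‖toCLM g‖ + ‖toCLM h‖ := by
  refine tendsto_nhds_unique (tendsto_mul_self_approximateUnit f) ?_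
  refine ((tendsto_mul_self_approximateUnit g).add (tendsto_mul_self_approximateUnit h)).congr ?_
  intro e
  rw [hf, Complex.add_re]

theorem exists_positive_smul (f : A →ₚ[ℂ] ℂ) {r : ℝ} (hr : 0 ≤ r) :
    ∃ g : A →ₚ[ℂ] ℂ, (∀ a, g a = r * f a) ∧ ‖toCLM g‖ = r * ‖toCLM f‖ := by
  let g : A →ₚ[ℂ] ℂ := PositiveLinearMap.mk₀ ((r : ℂ) • f.toLinearMap) fun a ha =>
    mul_nonneg (Complex.zero_le_real.2 hr) (f.map_nonneg ha)
  have hg : ∀ a, g a = r * f a := fun a => rfl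
  refine ⟨g, hg, ?_⟩
  have : toCLM g = (r : ℂ) • toCLM f := by
    ext a
    exact hg a
  rw [this, norm_smul, Complex.norm_real, Real.norm_of_nonneg hr]

/-- The positive cone is closed, so the Hahn-Banach theorem separates it from `-c`. The
real functional so obtained is made compatible with the involution and then complexified. -/
theorem exists_positive_apply_re_pos {c : A} (hc : 0 ≤ c) (hc0 : c ≠ 0) :
    ∃ f : A →ₚ[ℂ] ℂ, 0 < (f c).re := by
  have hmem : -c ∉ ProperCone.positive ℝ A := fun h => by
    rw [ProperCone.mem_positive] at h
    exact hc0 (le_antisymm (neg_nonneg.1 h) hc)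
  obtain ⟨l, hl, hlc⟩ := ProperCone.hyperplane_separation_point _ hmem
  let h : A →ₗ[ℝ] ℝ :=
    { toFun := fun a => l (a + star a)
      map_add' := fun a b => by rw [← map_add, star_add]; congr 1; abel
      map_smul' := fun r a => by simp [star_smul, mul_add] }
  have hh : ∀ a, h a = l (a + star a) := fun a => rfl
  let g : A →ₗ[ℂ] ℂ := Module.Dual.extendRCLike (𝕜 := ℂ) h
  have hg : ∀ a : A, IsSelfAdjoint a → g a = ((l (a + a) : ℝ) : ℂ) := fun a ha => by
    have h1 : h (Complex.I • a) = 0 := by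
      rw [hh, star_smul, ha.star_eq]
      simp
    have h2 : g a = (h a : ℂ) - Complex.I * (h (Complex.I • a) : ℂ) :=
      Module.Dual.extendRCLike_apply h a
    rw [h2, h1, hh, ha.star_eq]
    simp
  have hpos : ∀ a : A, 0 ≤ a → 0 ≤ g a := fun a ha => by
    rw [hg a (.of_nonneg ha)]
    exact Complex.zero_le_real.2 (hl _ (ProperCone.mem_positive.2 (add_nonneg ha ha)))
  refine ⟨PositiveLinearMap.mk₀ g hpos, ?_⟩
  change 0 < (g c).re
  rw [hg c (.of_nonneg hc), Complex.ofReal_re, map_add]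
  rw [map_neg] at hlc
  linarith

variable (A) in
/-- The positive functionals of norm at most one, as functions on `A` with the topology of
pointwise convergence. -/
def quasiStates : Set (A → ℂ) := {φ | ∃ f : A →ₚ[ℂ] ℂ, ‖toCLM f‖ ≤ 1 ∧ ∀ a, f a = φ a}

theorem isCompact_quasiStates : IsCompact (quasiStates A) := by
  have h : quasiStates A = (Set.univ.pi fun a : A => Metric.closedBall (0 : ℂ) ‖a‖) ∩
      ({φ | ∀ a b, φ (a + b) = φ a + φ b} ∩ {φ | ∀ (z : ℂ) a, φ (z • a) = z * φ a} ∩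
        {φ | ∀ a, 0 ≤ a → 0 ≤ φ a}) := by
    ext φ
    constructor
    · rintro ⟨f, hf, hφ⟩
      refine ⟨fun a _ => ?_, ⟨fun a b => ?_, fun z a => ?_⟩, fun a ha => ?_⟩
      · rw [mem_closedBall_zero_iff, ← hφ]
        simpa using (toCLM f).le_of_opNorm_le hf a
      · simp only [← hφ, map_add]
      · simp only [← hφ, map_smul, smul_eq_mul]
      · rw [← hφ]
        exact f.map_nonneg ha
    · rintro ⟨h1, ⟨h2, h3⟩, h4⟩
      refine ⟨PositiveLinearMap.mk₀ { toFun := φ, map_add' := h2, map_smul' := h3 } h4, ?_,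
        fun a => rfl⟩
      refine ContinuousLinearMap.opNorm_le_bound _ zero_le_one fun a => ?_
      rw [one_mul]
      exact mem_closedBall_zero_iff.1 (h1 a trivial)
  rw [h]
  refine (isCompact_univ_pi fun a => isCompact_closedBall _ _).inter_right ?_
  refine (IsClosed.inter ?_ ?_).inter ?_
  · simp only [Set.ofPred_forall]
    exact isClosed_iInter fun a => isClosed_iInter fun b => isClosed_eq (by fun_prop) (by fun_prop)
  · simp only [Set.ofPred_forall]
    exact isClosed_iInter fun z => isClosed_iInter fun a => isClosed_eq (by fun_prop) (by fun_prop)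
  · simp only [Set.ofPred_forall]
    exact isClosed_iInter fun a => isClosed_iInter fun _ =>
      isClosed_le continuous_const (by fun_prop)

theorem toFun_mem_quasiStates {f : A →ₚ[ℂ] ℂ} (hf : ‖toCLM f‖ ≤ 1) : ⇑f ∈ quasiStates A :=
  ⟨f, hf, fun _ => rfl⟩

theorem eq_zero_of_norm_toCLM_eq_zero {f : A →ₚ[ℂ] ℂ} (h : ‖toCLM f‖ = 0) (a : A) : f a = 0 := by
  rw [← toCLM_apply, norm_eq_zero.1 h, zero_apply]

/-- If `f = g + h` with positive nonzero `g`, `h`, then `f` lies in the open segment between the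
normalizations of `g` and `h`. -/
theorem apply_eq_norm_mul_of_extreme {f g h : A →ₚ[ℂ] ℂ}
    (hext : ⇑f ∈ (quasiStates A).extremePoints ℝ) (hf : ‖toCLM f‖ = 1)
    (hgh : ∀ a, f a = g a + h a) (a : A) : g a = ‖toCLM g‖ * f a := by
  have hadd := norm_toCLM_add hgh
  rw [hf] at hadd
  rcases (norm_nonneg (toCLM g)).eq_or_lt with hg0 | hg0
  · rw [← hg0, Complex.ofReal_zero, zero_mul, eq_zero_of_norm_toCLM_eq_zero hg0.symm]
  rcases (norm_nonneg (toCLM h)).eq_or_lt with hh0 | hh0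
  · have h1 : ‖toCLM g‖ = 1 := by linarith
    rw [h1, Complex.ofReal_one, one_mul, hgh, eq_zero_of_norm_toCLM_eq_zero hh0.symm, add_zero]
  obtain ⟨g', hg', hgn⟩ := exists_positive_smul g (inv_nonneg.2 hg0.le)
  obtain ⟨h', hh', hhn⟩ := exists_positive_smul h (inv_nonneg.2 hh0.le)
  rw [inv_mul_cancel₀ hg0.ne'] at hgn
  rw [inv_mul_cancel₀ hh0.ne'] at hhn
  have hgC : ((‖toCLM g‖ : ℝ) : ℂ) ≠ 0 := Complex.ofReal_ne_zero.2 hg0.ne'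
  have hhC : ((‖toCLM h‖ : ℝ) : ℂ) ≠ 0 := Complex.ofReal_ne_zero.2 hh0.ne'
  have heq : ⇑g' = ⇑f := hext.2 (toFun_mem_quasiStates hgn.le) (toFun_mem_quasiStates hhn.le)
    ⟨_, _, hg0, hh0, hadd.symm, by
      ext a
      simp only [Pi.add_apply, Pi.smul_apply, Complex.real_smul, hg', hh', hgh,
        Complex.ofReal_inv]
      rw [mul_inv_cancel_left₀ hgC, mul_inv_cancel_left₀ hhC]⟩
  rw [← heq, hg', Complex.ofReal_inv, mul_inv_cancel_left₀ hgC]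

/-- A nonzero extreme point has norm one: otherwise it lies in the open segment between `0` and its
normalization. -/
theorem norm_toCLM_eq_one_of_extreme {f : A →ₚ[ℂ] ℂ}
    (hext : ⇑f ∈ (quasiStates A).extremePoints ℝ) (hf : ‖toCLM f‖ ≤ 1) (h0 : ‖toCLM f‖ ≠ 0) :
    ‖toCLM f‖ = 1 := by
  by_contra h1
  have hlt : ‖toCLM f‖ < 1 := lt_of_le_of_ne hf h1
  have hpos : 0 < ‖toCLM f‖ := (norm_nonneg _).lt_of_ne' h0
  obtain ⟨g, hg, hgn⟩ := exists_positive_smul f (inv_nonneg.2 hpos.le)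
  obtain ⟨z, hz, hzn⟩ := exists_positive_smul f le_rfl
  rw [inv_mul_cancel₀ h0] at hgn
  rw [zero_mul] at hzn
  have hC : ((‖toCLM f‖ : ℝ) : ℂ) ≠ 0 := Complex.ofReal_ne_zero.2 h0
  have heq : ⇑z = ⇑f := hext.2 (toFun_mem_quasiStates (hzn.trans_le zero_le_one))
    (toFun_mem_quasiStates hgn.le) ⟨1 - ‖toCLM f‖, ‖toCLM f‖, sub_pos.2 hlt, hpos, by ring, by
      ext a
      simp only [Pi.add_apply, Pi.smul_apply, Complex.real_smul, hg, hz, Complex.ofReal_inv,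
        Complex.ofReal_zero, zero_mul, mul_zero, zero_add]
      rw [mul_inv_cancel_left₀ hC]⟩
  have : f = z := DFunLike.coe_injective heq.symm
  rw [this] at h0
  exact h0 hzn

/-- Pure states detect every nonzero positive element `c`. By compactness, the evaluation at `c` is
maximal on a closed face of the quasi-states, and an extreme point of this face is a pure state. -/
theorem PureState.exists_apply_ne_zero {c : A} (hc : 0 ≤ c) (hc0 : c ≠ 0) :
    ∃ ω : PureState A, ω.toFunctional c ≠ 0 := by
  obtain ⟨f₀, hf₀⟩ := exists_positive_apply_re_pos hc hc0
  have hn₀ : ‖toCLM f₀‖ ≠ 0 := fun h => by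
    rw [eq_zero_of_norm_toCLM_eq_zero h] at hf₀
    exact lt_irrefl _ hf₀
  obtain ⟨f₁, hf₁, hn₁⟩ := exists_positive_smul f₀ (inv_nonneg.2 (norm_nonneg (toCLM f₀)))
  rw [inv_mul_cancel₀ hn₀] at hn₁
  have hf₁c : 0 < (f₁ c).re := by
    rw [hf₁, Complex.re_ofReal_mul]
    exact mul_pos (inv_pos.2 ((norm_nonneg _).lt_of_ne' hn₀)) hf₀
  let l : StrongDual ℝ (A → ℂ) := Complex.reCLM.comp (ContinuousLinearMap.proj (R := ℝ) c)
  have hl : ∀ φ : A → ℂ, l φ = (φ c).re := fun φ => rfl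
  have hexp : IsExposed ℝ (quasiStates A) (l.toExposed (quasiStates A)) :=
    ContinuousLinearMap.toExposed.isExposed
  obtain ⟨φ, hφ, hmax⟩ := (isCompact_quasiStates (A := A)).exists_isMaxOn
    ⟨_, toFun_mem_quasiStates hn₁.le⟩ l.continuous.continuousOn
  obtain ⟨χ, hχ⟩ := (hexp.isCompact isCompact_quasiStates).extremePoints_nonempty ⟨φ, hφ, hmax⟩
  have hχmax : (f₁ c).re ≤ (χ c).re := hχ.1.2 _ (toFun_mem_quasiStates hn₁.le)
  have hext := hexp.isExtreme.extremePoints_subset_extremePoints hχ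
  obtain ⟨f, hf, hfχ⟩ := hext.1
  obtain rfl : ⇑f = χ := funext hfχ
  have hn0 : ‖toCLM f‖ ≠ 0 := fun h => by
    rw [eq_zero_of_norm_toCLM_eq_zero h, Complex.zero_re] at hχmax
    exact hf₁c.not_ge hχmax
  have hn := norm_toCLM_eq_one_of_extreme hext hf hn0
  refine ⟨⟨f, hn, fun ψ hψ => ?_⟩, fun h => ?_⟩
  · let ρ : A →ₚ[ℂ] ℂ := PositiveLinearMap.mk₀ (f.toLinearMap - ψ.toLinearMap) fun a ha =>
      sub_nonneg.2 (hψ a ha)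
    have hρ : ∀ a, f a = ψ a + ρ a := fun a => (add_sub_cancel (ψ a) (f a)).symm
    have hadd := norm_toCLM_add hρ
    refine ⟨‖toCLM ψ‖, norm_nonneg _, ?_, apply_eq_norm_mul_of_extreme hext hn hρ⟩
    rw [← hn, hadd]
    exact le_add_of_nonneg_right (norm_nonneg _)
  · change f c = 0 at h
    rw [h, Complex.zero_re] at hχmax
    exact hf₁c.not_ge hχmax

end States

/-! ### Irreducible representations and closed ideals -/

/-- Irreducible representations separate the points of a C⋆-algebra. -/
theorem Irrep.exists_hom_ne_zero {A : Type u} [NonUnitalCStarAlgebra A] {a : A} (ha : a ≠ 0) :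
    ∃ π : Irrep A, π.1.hom a ≠ 0 := by
  let _ := CStarAlgebra.spectralOrder A
  have _ := CStarAlgebra.spectralOrderedRing A
  obtain ⟨ω, hω⟩ := PureState.exists_apply_ne_zero (star_mul_self_nonneg a)
    ((CStarRing.star_mul_self_ne_zero_iff a).2 ha)
  obtain ⟨ξ, -, -, h⟩ := ω.exists_gns_vector
  refine ⟨ω.irrep, fun h0 => hω ?_⟩
  have h0' : ω.gns.hom a = 0 := h0
  rw [h, map_mul, h0', mul_zero]
  simp

namespace ClosedIdeal

variable {A : Type u} [NonUnitalCStarAlgebra A]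

/-- Composition of an irreducible representation of `A / I` with the quotient map. -/
def Quot.liftIrrep {I : ClosedIdeal A} (π : Irrep I.Quot) : Irrep A :=
  ⟨{ H := π.1.H, hom := π.1.hom.comp (Quot.mkHom I) }, fun h0 => π.2.1 (by
      ext1 x
      obtain ⟨a, rfl⟩ := Quot.mkHom_surjective x
      exact DFunLike.congr_fun h0 a), fun K hK hinv => π.2.2 K hK fun x => by
      obtain ⟨a, rfl⟩ := Quot.mkHom_surjective x
      exact hinv a⟩

/-- A closed ideal is an intersection of primitive ideals. -/
theorem exists_irrep_of_notMem {I : ClosedIdeal A} {a : A} (ha : a ∉ I) :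
    ∃ π : Irrep A, (∀ b ∈ I, π.1.hom b = 0) ∧ π.1.hom a ≠ 0 := by
  obtain ⟨π, hπ⟩ := Irrep.exists_hom_ne_zero (mt Quot.mkHom_eq_zero.1 ha)
  refine ⟨Quot.liftIrrep π, fun b hb => ?_, hπ⟩
  change π.1.hom (Quot.mkHom I b) = 0
  rw [Quot.mkHom_eq_zero.2 hb, map_zero]

end ClosedIdeal

/-! ### Open subsets of the spectrum -/

theorem Prim.isClosed_iff {A : Type u} [NonUnitalCStarAlgebra A] {V : Set (Prim A)} :
    IsClosed V ↔ ∃ S : Set A, hull S = V := by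
  rw [← isOpen_compl_iff]
  change Vᶜᶜ ∈ Set.range hull ↔ _
  rw [compl_compl, Set.mem_range]

namespace Spectrum

variable {A : Type u} [NonUnitalCStarAlgebra A]

theorem notMem_support_iff {I : ClosedIdeal A} {x : Spectrum A} :
    x ∉ support I ↔ (I : Set A) ⊆ x.ker := by
  constructor
  · intro h a ha
    induction x using Quotient.inductionOn with | _ π
    by_contra h'
    exact h ⟨π, rfl, a, ha, h'⟩
  · rintro h ⟨π, rfl, a, ha, h'⟩
    exact h' (h ha)

theorem mem_iff_of_notMem_support {I : ClosedIdeal A} {a : A} :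
    a ∈ I ↔ ∀ x ∉ support I, a ∈ x.ker := by
  refine ⟨fun ha x hx => notMem_support_iff.1 hx ha, fun h => ?_⟩
  by_contra ha
  obtain ⟨π, hπ, hπa⟩ := ClosedIdeal.exists_irrep_of_notMem ha
  exact hπa (h π.cls (notMem_support_iff.2 hπ))

theorem support_injective : Function.Injective (support (A := A)) := fun I J h =>
  SetLike.ext fun a => by rw [mem_iff_of_notMem_support, mem_iff_of_notMem_support, h]

theorem isClosed_iff {V : Set (Spectrum A)} :
    IsClosed V ↔ ∃ S : Set A, V = {x | S ⊆ x.ker} := by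
  rw [isClosed_induced_iff]
  constructor
  · rintro ⟨T, hT, rfl⟩
    obtain ⟨S, rfl⟩ := Prim.isClosed_iff.1 hT
    exact ⟨S, rfl⟩
  · rintro ⟨S, rfl⟩
    exact ⟨hull S, Prim.isClosed_iff.2 ⟨S, rfl⟩, rfl⟩

theorem isOpen_support (I : ClosedIdeal A) : IsOpen (support I) := by
  rw [← isClosed_compl_iff, isClosed_iff]
  exact ⟨I, Set.ext fun x => notMem_support_iff⟩

/-- The intersection of the kernels of the classes in `V`. -/
def kernel (V : Set (Spectrum A)) : ClosedIdeal A where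
  carrier := {a | ∀ x ∈ V, a ∈ x.ker}
  add_mem' ha hb x hx := x.ker.add_mem (ha x hx) (hb x hx)
  zero_mem' x _ := x.ker.zero_mem
  smul_mem' c _ ha x hx := x.ker.smul_mem c (ha x hx)
  mul_mem_left' a _ hb x hx := x.ker.mul_mem_left a (hb x hx)
  mul_mem_right' b ha x hx := x.ker.mul_mem_right b (ha x hx)
  isClosed' := by
    simp only [Set.ofPred_forall]
    exact isClosed_biInter fun x _ => x.ker.isClosed'

theorem support_kernel_compl {U : Set (Spectrum A)} (hU : IsOpen U) : support (kernel Uᶜ) = U := by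
  obtain ⟨S, hS⟩ := isClosed_iff.1 hU.isClosed_compl
  rw [← compl_inj_iff]
  ext x
  rw [Set.mem_compl_iff, notMem_support_iff]
  constructor
  · intro h
    rw [hS]
    intro a ha
    refine h fun y hy => ?_
    rw [hS] at hy
    exact hy ha
  · exact fun hx a ha => ha x hx

end Spectrum

/-! ### Direct sums and restrictions of bundles -/

theorem Rep.directSum_hom_eq_zero_iff {A : Type u} [NonUnitalCStarAlgebra A] {ι : Type w}
    (π : ι → Rep.{u, v} A) (a : A) :
    (Rep.directSum π).hom a = 0 ↔ ∀ i, (π i).hom a = 0 := by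
  classical
  change directSumOp π a = 0 ↔ _
  constructor
  · intro h i
    ext x
    have h1 := congrArg (fun T => (T (lp.single 2 i x)) i) h
    simpa using h1
  · intro h
    ext x i
    rw [directSumOp_apply, h]
    rfl

theorem KahlerBundle.restrict_ukb_injective {A : Type u} [NonUnitalCStarAlgebra A] [PartialOrder A]
    [StarOrderedRing A] : Function.Injective ((ukb A).restrict) := fun U V h => by
  have := congrArg KahlerBundle.base h
  ext x
  simpa [KahlerBundle.restrict, ukb] using Set.ext_iff.1 this x

end

end CStarUKB

open CStarUKB in
theorem proposition2p6 {A : Type*} [NonUnitalCStarAlgebra A] [PartialOrder A]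
    [StarOrderedRing A] :
    -- closed ideals and restrictions to open subsets
    (Set.BijOn (fun I : CStarUKB.ClosedIdeal A =>
        (CStarUKB.ukb A).restrict (CStarUKB.Spectrum.support I))
        Set.univ (CStarUKB.bunOpen A) ∧
      -- the direct sum is taken over any choice of representatives of the classes
      ∀ (I : CStarUKB.ClosedIdeal A)
        (r : ((CStarUKB.Spectrum.support I)ᶜ : Set (CStarUKB.Spectrum A)) → CStarUKB.Irrep A),
        (∀ x, (r x).cls = x.1) →
          I = (CStarUKB.Rep.directSum fun x => (r x).1).ker) ∧
    -- each closed ideal has exactly one quotient C⋆-algebra `A / I`, and quotients correspond to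
    -- restrictions to closed subsets
    ((∀ I : CStarUKB.ClosedIdeal A, ∃! Q : CStarUKB.QuotientAlgebra A, Q.ideal = I) ∧
      Set.BijOn (fun Q : CStarUKB.QuotientAlgebra A =>
        (CStarUKB.ukb A).restrict (CStarUKB.Spectrum.support Q.ideal)ᶜ)
        Set.univ (CStarUKB.bunClosed A)) := by
  refine ⟨⟨⟨?_, ?_, ?_⟩, ?_⟩, ?_, ?_, ?_, ?_⟩
  · exact fun I _ => ⟨_, Spectrum.isOpen_support I, rfl⟩
  · exact fun I _ J _ h => Spectrum.support_injective (KahlerBundle.restrict_ukb_injective h)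
  · rintro _ ⟨U, hU, rfl⟩
    exact ⟨Spectrum.kernel Uᶜ, trivial, congrArg _ (Spectrum.support_kernel_compl hU)⟩
  · intro I r hr
    refine SetLike.ext fun a => ?_
    rw [Spectrum.mem_iff_of_notMem_support]
    refine Iff.trans ?_ (Rep.directSum_hom_eq_zero_iff (fun x => (r x).1) a).symm
    constructor
    · intro h x
      have h1 := h x.1 x.2
      rw [← hr x] at h1
      exact h1
    · intro h x hx
      have h1 : a ∈ ((r ⟨x, hx⟩).cls).ker := h ⟨x, hx⟩
      rwa [hr ⟨x, hx⟩] at h1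
  · intro I
    obtain ⟨Q, rfl⟩ := QuotientAlgebra.exists_ideal_eq I
    exact ⟨Q, rfl, fun P hP => QuotientAlgebra.ideal_injective hP⟩
  · exact fun Q _ => ⟨_, (Spectrum.isOpen_support Q.ideal).isClosed_compl, rfl⟩
  · exact fun P _ Q _ h => QuotientAlgebra.ideal_injective (Spectrum.support_injective
      (compl_injective (KahlerBundle.restrict_ukb_injective h)))
  · rintro _ ⟨V, hV, rfl⟩
    obtain ⟨Q, hQ⟩ := QuotientAlgebra.exists_ideal_eq (Spectrum.kernel Vᶜᶜ)
    refine ⟨Q, trivial, congrArg _ ?_⟩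
    rw [hQ, Spectrum.support_kernel_compl hV.isOpen_compl, compl_compl]
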